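/- Let $\beta>1$ and let $t_\beta\in(0,1)$ be the unique positive solution of $t=\tanh(\beta t)$. For $n\ge 1$ let $\tilde\nu_{n,\beta}$ be the probability measure on $[0,1]$ with density proportional to $$p\mapsto \exp\Big(-\frac{n}{2\beta}\operatorname{Argtanh}(2p-1)^2-\Big(\frac n2+1\Big)\ln\big(1-(2p-1)^2\big)\Big).$$ Let $U_1,\dots,U_n$ be i.i.d. uniform on $[0,1]$ (a new family for each $n$ is allowed) and let $V_n\sim\tilde\nu_{n,\beta}$ be independent of $(U_1,\dots,U_n)$. Put $$X_k^{(\beta)}:=2\cdot\mathbf 1_{\{U_k<V_n\}}-1,\qquad M_n:=\sum_{k=1}^n X_k^{(\beta)},\qquad T_n:=2V_n-1 .$$ Let $(\hat Z(p))_{p\in[0,1]}$ be a standard Brownian bridge (continuous centred Gaussian process with $\mathbb E[\hat Z(p)\hat Z(q)]=p\wedge q-pq$), let $G^{\pm}:=2\hat Z\big(\tfrac{1\pm t_\beta}{2}\big)$, and let $B$ be uniform on $\{-1,1\}$ and independent of $(G^+,G^-)$. Then: 1. for every $n\ge1$, $(X_1^{(\beta)},\dots,X_n^{(\beta)})$ has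 the Curie--Weiss law at inverse temperature $\beta$, i.e. the law on $\{-1,1\}^n$ with probabilities proportional to $\exp\big(\frac{\beta}{2n}(x_1+\dots+x_n)^2\big)$, so $M_n$ is the Curie--Weiss magnetisation; 2. $\dfrac{M_n}{n}\to t_\beta B$ in law as $n\to\infty$; 3. the pair converges jointly in law as $n\to\infty$: $$\Big(\sqrt n\Big(\frac{M_n}{n}-T_n\Big),\,T_n\Big)\longrightarrow\Big(\frac{1+B}{2}G^++\frac{1-B}{2}G^-,\;t_\beta B\Big);$$ 4. $(G^+,G^-)$ is a centred Gaussian vector with $\mathbb E[G^+G^-]=(1-t_\beta)^2$. -/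

import Mathlib

open MeasureTheory ProbabilityTheory Filter Topology

noncomputable section

namespace CurieWeiss

/-- The symmetric Bernoulli law on `{-1, 1}`. -/
def signLaw : Measure ℝ :=
  (2⁻¹ : ENNReal) • Measure.dirac (1 : ℝ) + (2⁻¹ : ENNReal) • Measure.dirac (-1 : ℝ)

/-- The Curie-Weiss law of `n` spins at inverse temperature `β` (no external field): the law of
`n` i.i.d. symmetric signs, biased by `exp (β / (2 n) * S_n ^ 2)` and normalised. -/
def curieWeissLaw (n : ℕ) (β : ℝ) : Measure (Fin n → ℝ) :=
  (Measure.pi fun _ : Fin n => signLaw).tilted fun x => β / (2 * n) * (∑ k, x k) ^ 2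

/-- The density of the De Finetti measure on `[0, 1]`, before normalisation. -/
def deFinettiWeight (n : ℕ) (β p : ℝ) : ℝ :=
  Real.exp (-(n / (2 * β)) * Real.artanh (2 * p - 1) ^ 2
    - ((n : ℝ) / 2 + 1) * Real.log (1 - (2 * p - 1) ^ 2))

/-- The De Finetti measure of the Curie-Weiss model with `n ≥ 1` spins. -/
def deFinettiMeasure (n : ℕ) (β : ℝ) : Measure ℝ :=
  (volume.restrict (Set.Icc (0 : ℝ) 1)).withDensity fun p =>
    ENNReal.ofReal (deFinettiWeight n β p / ∫ q in Set.Icc (0 : ℝ) 1, deFinettiWeight n β q)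

/-- The spin `2 * 1_{u < p} - 1`: for `u` uniform on `[0, 1]`, a sign that is `1` with
probability `p`. -/
def spin (u p : ℝ) : ℝ := 2 * (if u < p then 1 else 0) - 1

/-- The unnormalised magnetisation built from the uniform variables `u` and the parameter `p`. -/
def magnetisation {n : ℕ} (u : Fin n → ℝ) (p : ℝ) : ℝ := ∑ k, spin (u k) p

/-- `Z` restricted to the time interval `[0, 1]` is a standard Brownian bridge from `0` to `0`:
a centred Gaussian process with covariance `min p q - p * q` and almost surely continuous paths. -/
structure IsBrownianBridge {Ω : Type*} [MeasurableSpace Ω] (Z : ℝ → Ω → ℝ) (P : Measure Ω) :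
    Prop where
  isGaussianProcess : IsGaussianProcess (fun p : Set.Icc (0 : ℝ) 1 => Z p) P
  centred : ∀ p ∈ Set.Icc (0 : ℝ) 1, ∫ ω, Z p ω ∂P = 0
  covariance : ∀ p ∈ Set.Icc (0 : ℝ) 1, ∀ q ∈ Set.Icc (0 : ℝ) 1,
    ∫ ω, Z p ω * Z q ω ∂P = min p q - p * q
  continuousOn : ∀ᵐ ω ∂P, ContinuousOn (fun p => Z p ω) (Set.Icc 0 1)

end CurieWeiss

end

/-! The substitution `p = (1 + tanh y) / 2` governs everything. Its Jacobian cancels the extra `+ 1`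
in the De Finetti exponent, so the measure becomes the law on the line with density proportional to
`w y ^ n`, where `w y = exp (-y² / (2β)) * cosh y` is `hsWeight`.

Curie-Weiss law: given the parameter, the spins have density `∏ (1 + tanh y * x k)` with respect to
fair signs. Since `cosh y * (1 + tanh y * x) = exp (y * x)` for `x = ±1`, mixing over `y` is a
Gaussian integral, and completing the square leaves the weight `exp (β / (2n) * S²)`.

Concentration: `w` is even and its logarithmic derivative is `tanh y - y / β`. By concavity of
`tanh` it is unimodal on the half-line with peak at `β * t`, so Laplace's method puts mass one half
near each of the values `±t` of `2p - 1` (`tendsto_integral_deFinettiMeasure`).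

Limits: given `p`, `M - n * T` is a sum of `n` i.i.d. centred variables of variance `1 - (2p - 1)²`.
Its characteristic function is close to a Gaussian one uniformly in `p`
(`norm_siteCharFun_pow_sub_exp_le`), so it can be replaced under the De Finetti integral before
concentration is applied. Scale `a / √n` gives the joint fluctuations, scale `a / n` the law of
large numbers. In the limit `B` selects one of the two Gaussians, so only their marginals matter. -/

noncomputable section

namespace CurieWeiss

/-! ### Laplace's method -/

/-- Laplace's method without compactness: if `c` stays away from its value at `x₀` outside every
neighbourhood of `x₀`, the normalised powers of `c` concentrate at `x₀`. -/
theorem tendsto_setIntegral_pow_smul_of_gap {α E : Type*} [TopologicalSpace α] [MeasurableSpace α]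
    [BorelSpace α] [NormedAddCommGroup E] [NormedSpace ℝ E] [CompleteSpace E]
    {μ : Measure α} [IsFiniteMeasure μ] {s : Set α} (hs : MeasurableSet s)
    {c : α → ℝ} {g : α → E} {x₀ : α}
    (hμ : ∀ u, IsOpen u → x₀ ∈ u → 0 < μ (u ∩ s)) (hc : Continuous c) (hpos : ∀ x, 0 < c x)
    {C : ℝ} (hbdd : ∀ x, c x ≤ C)
    (hgap : ∀ u, IsOpen u → x₀ ∈ u → ∃ r < c x₀, ∀ x ∈ s, x ∉ u → c x ≤ r)
    (hmg : IntegrableOn g s μ) (hcg : ContinuousAt g x₀) :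
    Tendsto (fun n : ℕ => (∫ x in s, c x ^ n ∂μ)⁻¹ • ∫ x in s, c x ^ n • g x ∂μ) atTop
      (𝓝 (g x₀)) := by
  let φ : ℕ → α → ℝ := fun n x => (∫ x in s, c x ^ n ∂μ)⁻¹ * c x ^ n
  have hI : ∀ n, Integrable (fun x => c x ^ n) μ := fun n =>
    Integrable.of_bound (hc.pow n).measurable.aestronglyMeasurable (C ^ n) (ae_of_all _ fun x => by
      rw [norm_pow, Real.norm_of_nonneg (hpos x).le]
      exact pow_le_pow_left₀ (hpos x).le (hbdd x) n)
  have hlow : ∀ v, MeasurableSet v → ∀ r, 0 ≤ r → (∀ x ∈ v, r ≤ c x) → ∀ n,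
      r ^ n * μ.real (v ∩ s) ≤ ∫ x in s, c x ^ n ∂μ := by
    intro v hv r hr hvr n
    calc r ^ n * μ.real (v ∩ s) = ∫ _ in v ∩ s, r ^ n ∂μ := by simp [mul_comm]
      _ ≤ ∫ x in v ∩ s, c x ^ n ∂μ :=
        setIntegral_mono_on (by simp) (hI n).integrableOn (hv.inter hs)
          fun x hx => pow_le_pow_left₀ hr (hvr x hx.1) n
      _ ≤ ∫ x in s, c x ^ n ∂μ :=
        setIntegral_mono_set (hI n).integrableOn
          (ae_of_all _ fun x => (pow_pos (hpos x) n).le)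
          (Eventually.of_forall Set.inter_subset_right)
  have hreal : ∀ u, IsOpen u → x₀ ∈ u → 0 < μ.real (u ∩ s) := fun u hu hx =>
    ENNReal.toReal_pos (hμ u hu hx).ne' (measure_ne_top _ _)
  have hP : ∀ n, 0 < ∫ x in s, c x ^ n ∂μ := by
    intro n
    have hv : IsOpen (c ⁻¹' Set.Ioi (c x₀ / 2)) := isOpen_Ioi.preimage hc
    have hx : x₀ ∈ c ⁻¹' Set.Ioi (c x₀ / 2) := by
      simpa using hpos x₀
    have := hpos x₀
    exact (mul_pos (by positivity) (hreal _ hv hx)).trans_le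
      (hlow _ hv.measurableSet (c x₀ / 2) (by positivity) (fun x hx => le_of_lt hx) n)
  have hnφ : ∀ n, ∀ x ∈ s, 0 ≤ φ n x := fun n x _ =>
    mul_nonneg (inv_nonneg.2 (hP n).le) (pow_pos (hpos x) n).le
  have hunif : ∀ u : Set α, IsOpen u → x₀ ∈ u → TendstoUniformlyOn φ 0 atTop (s \ u) := by
    intro u hu hxu
    obtain ⟨r₀, hr₀, hr₀'⟩ := hgap u hu hxu
    obtain ⟨r, hr0, hr, hle⟩ : ∃ r, 0 ≤ r ∧ r < c x₀ ∧ ∀ x ∈ s, x ∉ u → c x ≤ r :=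
      ⟨max r₀ 0, le_max_right _ _, max_lt hr₀ (hpos x₀),
        fun x hx hxu => (hr₀' x hx hxu).trans (le_max_left _ _)⟩
    -- A level strictly between the gap and the peak: the normaliser is at least `r' ^ n` times the
    -- mass `m` of `{c > r'}`, so the kernel decays like `(r / r') ^ n` off `u`.
    obtain ⟨r', hrr', hr'⟩ := exists_between hr
    have hr'0 : 0 < r' := hr0.trans_lt hrr'
    have hv : IsOpen (c ⁻¹' Set.Ioi r') := isOpen_Ioi.preimage hc
    have hm := hreal _ hv hr'
    set m := μ.real (c ⁻¹' Set.Ioi r' ∩ s)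
    have hM : ∀ n, ∀ x ∈ s \ u, φ n x ≤ m⁻¹ * (r / r') ^ n := by
      intro n x hx
      have hB := hlow _ hv.measurableSet r' hr'0.le (fun x hx => le_of_lt hx) n
      simp_rw [φ, ← div_eq_inv_mul, div_pow, div_div]
      have := hle x hx.1 hx.2
      have := (hpos x).le
      gcongr
    have hN : Tendsto (fun n => m⁻¹ * (r / r') ^ n) atTop (𝓝 (m⁻¹ * 0)) :=
      tendsto_const_nhds.mul (tendsto_pow_atTop_nhds_zero_of_lt_one (div_nonneg hr0 hr'0.le)
        ((div_lt_one hr'0).2 hrr'))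
    rw [mul_zero] at hN
    refine Metric.tendstoUniformlyOn_iff.2 fun ε hε => ?_
    filter_upwards [(tendsto_order.1 hN).2 ε hε] with n hn x hx
    simp only [Pi.zero_apply, dist_zero_left, Real.norm_of_nonneg (hnφ n x hx.1)]
    exact (hM n x hx).trans_lt hn
  have hone : ∀ n, ∫ x in s, φ n x ∂μ = 1 := fun n => by
    rw [integral_const_mul, inv_mul_cancel₀ (hP n).ne']
  have := tendsto_setIntegral_peak_smul_of_integrableOn_of_tendsto hs hs subset_rfl
    self_mem_nhdsWithin (measure_ne_top _ _) (Eventually.of_forall hnφ) hunif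
    (tendsto_const_nhds.congr fun n => (hone n).symm)
    (Eventually.of_forall fun n => ((hI n).const_mul _).aestronglyMeasurable.restrict)
    hmg (hcg.tendsto.mono_left nhdsWithin_le_nhds)
  refine this.congr fun n => ?_
  simp_rw [φ, ← smul_smul, integral_smul]

/-! ### The Hubbard-Stratonovich weight -/

/-- The integrand of the Hubbard-Stratonovich transform. -/
def hsWeight (β y : ℝ) : ℝ := Real.exp (-y ^ 2 / (2 * β)) * Real.cosh y

lemma hsWeight_pos (β y : ℝ) : 0 < hsWeight β y := by
  unfold hsWeight; positivity

lemma continuous_hsWeight (β : ℝ) : Continuous (hsWeight β) := by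
  unfold hsWeight; fun_prop

lemma hsWeight_neg (β y : ℝ) : hsWeight β (-y) = hsWeight β y := by
  simp [hsWeight]

/-- Completing the square in both exponentials of `cosh`. Integrability and the uniform bound are
read off from this form. -/
lemma hsWeight_eq {β : ℝ} (hβ : 0 < β) (y : ℝ) :
    hsWeight β y = Real.exp (β / 2) / 2 *
      (Real.exp (-(1 / (2 * β)) * (y - β) ^ 2) + Real.exp (-(1 / (2 * β)) * (y + β) ^ 2)) := by
  rw [hsWeight, Real.cosh_eq, mul_add, div_mul_eq_mul_div, div_mul_eq_mul_div, ← Real.exp_add,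
    ← Real.exp_add, mul_div_assoc', mul_add, ← Real.exp_add, ← Real.exp_add, ← add_div]
  congr 3 <;> · field_simp; ring

lemma integrable_hsWeight {β : ℝ} (hβ : 0 < β) : Integrable (hsWeight β) := by
  have h := integrable_exp_neg_mul_sq (b := 1 / (2 * β)) (by positivity)
  have := ((h.comp_sub_right β).add (h.comp_add_right β)).const_mul (Real.exp (β / 2) / 2)
  exact this.congr (ae_of_all _ fun y => (hsWeight_eq hβ y).symm)

lemma hsWeight_le {β : ℝ} (hβ : 0 < β) (y : ℝ) : hsWeight β y ≤ Real.exp (β / 2) := by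
  rw [hsWeight_eq hβ]
  have h1 : Real.exp (-(1 / (2 * β)) * (y - β) ^ 2) ≤ 1 :=
    Real.exp_le_one_iff.2 (by rw [neg_mul]; exact neg_nonpos.2 (by positivity))
  have h2 : Real.exp (-(1 / (2 * β)) * (y + β) ^ 2) ≤ 1 :=
    Real.exp_le_one_iff.2 (by rw [neg_mul]; exact neg_nonpos.2 (by positivity))
  nlinarith [Real.exp_pos (β / 2)]

lemma integrable_hsWeight_pow {β : ℝ} (hβ : 0 < β) {n : ℕ} (hn : 0 < n) :
    Integrable (fun y => hsWeight β y ^ n) := by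
  obtain ⟨m, rfl⟩ := Nat.exists_eq_succ_of_ne_zero hn.ne'
  simp_rw [pow_succ]
  refine (integrable_hsWeight hβ).bdd_mul (c := Real.exp (β / 2) ^ m)
    ((continuous_hsWeight β).pow m).aestronglyMeasurable (ae_of_all _ fun y => ?_)
  rw [norm_pow, Real.norm_of_nonneg (hsWeight_pos β y).le]
  exact pow_le_pow_left₀ (hsWeight_pos β y).le (hsWeight_le hβ y) m

lemma integral_hsWeight_pow_pos {β : ℝ} (hβ : 0 < β) {n : ℕ} (hn : 0 < n) :
    0 < ∫ y, hsWeight β y ^ n :=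
  integral_pos_of_integrable_nonneg_nonzero (x := 0) ((continuous_hsWeight β).pow n)
    (integrable_hsWeight_pow hβ hn) (fun y => (pow_pos (hsWeight_pos β y) n).le)
    (pow_pos (hsWeight_pos β 0) n).ne'

/-! ### Unimodality of the weight on the positive half-line -/

lemma hasDerivAt_tanh (y : ℝ) : HasDerivAt Real.tanh (1 / Real.cosh y ^ 2) y := by
  have h := (Real.hasDerivAt_sinh y).div (Real.hasDerivAt_cosh y) (Real.cosh_pos y).ne'
  have e : Real.tanh = Real.sinh / Real.cosh := by
    funext x; simp [Real.tanh_eq_sinh_div_cosh]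
  rw [e]
  refine h.congr_deriv ?_
  rw [← Real.cosh_sq_sub_sinh_sq y]; ring

lemma hasDerivAt_hsWeight (β y : ℝ) :
    HasDerivAt (hsWeight β) (hsWeight β y * (Real.tanh y - y / β)) y := by
  have h1 : HasDerivAt (fun y : ℝ => -y ^ 2 / (2 * β)) (-(2 * y) / (2 * β)) y := by
    simpa using ((hasDerivAt_pow 2 y).neg.div_const (2 * β))
  refine (h1.exp.mul (Real.hasDerivAt_cosh y)).congr_deriv ?_
  have := (Real.cosh_pos y).ne'
  rw [hsWeight, Real.tanh_eq_sinh_div_cosh, neg_div (2 * β) (2 * y),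
    mul_div_mul_left _ _ two_ne_zero]
  field_simp
  ring

/-- `tanh` is strictly concave on the positive half-line. -/
lemma strictConcaveOn_tanh : StrictConcaveOn ℝ (Set.Ici 0) Real.tanh := by
  refine StrictAntiOn.strictConcaveOn_of_deriv (convex_Ici 0)
    (fun y _ => (hasDerivAt_tanh y).continuousAt.continuousWithinAt) ?_
  rw [interior_Ici]
  intro x hx y hy hxy
  simp only [(hasDerivAt_tanh _).deriv]
  have : Real.cosh x < Real.cosh y := Real.cosh_lt_cosh.2 (by
    rwa [abs_of_pos hx, abs_of_pos hy])
  have := Real.cosh_pos x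
  gcongr

/-- The chord of `tanh` from `0` to `β * t` has slope `1 / β`, and strict concavity puts the graph
above it. -/
lemma div_lt_tanh {β t y : ℝ} (hβ : 0 < β) (ht_pos : 0 < t) (ht : t = Real.tanh (β * t))
    (hy : 0 < y) (hy' : y < β * t) : y / β < Real.tanh y := by
  have hb : 0 < β * t := by positivity
  have h := strictConcaveOn_tanh.2 (Set.self_mem_Ici) (Set.mem_Ici.2 hb.le) hb.ne
    (show 0 < 1 - y / (β * t) by rw [sub_pos, div_lt_one hb]; exact hy')
    (show 0 < y / (β * t) by positivity) (by ring)
  simp only [smul_eq_mul, mul_zero, zero_add, Real.tanh_zero, ← ht] at h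
  rw [div_mul_cancel₀ _ hb.ne'] at h
  rwa [show y / (β * t) * t = y / β by field_simp] at h

/-- The same concavity with the chord from `0` to `y`, evaluated at the intermediate point `β * t`.
-/
lemma tanh_lt_div {β t y : ℝ} (hβ : 0 < β) (ht_pos : 0 < t) (ht : t = Real.tanh (β * t))
    (hy' : β * t < y) : Real.tanh y < y / β := by
  have hb : 0 < β * t := by positivity
  have hy : 0 < y := hb.trans hy'
  have h := strictConcaveOn_tanh.2 (Set.self_mem_Ici) (Set.mem_Ici.2 hy.le) hy.ne
    (show 0 < 1 - β * t / y by rw [sub_pos, div_lt_one hy]; exact hy')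
    (show 0 < β * t / y by positivity) (by ring)
  simp only [smul_eq_mul, mul_zero, zero_add, Real.tanh_zero] at h
  rw [div_mul_cancel₀ _ hy.ne', ← ht, div_mul_eq_mul_div, div_lt_iff₀ hy] at h
  rw [lt_div_iff₀ hβ]
  nlinarith

lemma strictMonoOn_hsWeight {β t : ℝ} (hβ : 0 < β) (ht_pos : 0 < t) (ht : t = Real.tanh (β * t)) :
    StrictMonoOn (hsWeight β) (Set.Icc 0 (β * t)) := by
  refine strictMonoOn_of_deriv_pos (convex_Icc _ _) (continuous_hsWeight β).continuousOn ?_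
  intro y hy
  rw [interior_Icc] at hy
  rw [(hasDerivAt_hsWeight β y).deriv]
  exact mul_pos (hsWeight_pos β y) (sub_pos.2 (div_lt_tanh hβ ht_pos ht hy.1 hy.2))

lemma strictAntiOn_hsWeight {β t : ℝ} (hβ : 0 < β) (ht_pos : 0 < t) (ht : t = Real.tanh (β * t)) :
    StrictAntiOn (hsWeight β) (Set.Ici (β * t)) := by
  refine strictAntiOn_of_deriv_neg (convex_Ici _) (continuous_hsWeight β).continuousOn ?_
  intro y hy
  rw [interior_Ici] at hy
  rw [(hasDerivAt_hsWeight β y).deriv]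
  exact mul_neg_of_pos_of_neg (hsWeight_pos β y) (sub_neg.2 (tanh_lt_div hβ ht_pos ht hy))

lemma hsWeight_gap {β t : ℝ} (hβ : 0 < β) (ht_pos : 0 < t) (ht : t = Real.tanh (β * t))
    {u : Set ℝ} (hu : IsOpen u) (hmem : β * t ∈ u) :
    ∃ r < hsWeight β (β * t), ∀ y, 0 < y → y ∉ u → hsWeight β y ≤ r := by
  have hb : 0 < β * t := by positivity
  obtain ⟨δ, hδ, hball⟩ := Metric.isOpen_iff.1 hu _ hmem
  -- Half of `δ` keeps `β * t ± ε` inside the ball; the cap `β * t` keeps the left point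
  -- nonnegative. By unimodality these two points dominate everything outside `u`.
  set ε := min (δ / 2) (β * t) with hε
  have hε0 : 0 < ε := lt_min (by positivity) hb
  have hεb : ε ≤ β * t := min_le_right _ _
  have hεδ : ε < δ := (min_le_left _ _).trans_lt (by linarith)
  have hm := strictMonoOn_hsWeight hβ ht_pos ht
  have ha := strictAntiOn_hsWeight hβ ht_pos ht
  refine ⟨max (hsWeight β (β * t - ε)) (hsWeight β (β * t + ε)), max_lt ?_ ?_, fun y hy hyu => ?_⟩
  · exact hm ⟨by linarith, by linarith⟩ ⟨hb.le, le_rfl⟩ (by linarith)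
  · exact ha Set.self_mem_Ici (Set.mem_Ici.2 (by linarith)) (by linarith)
  · have hd : δ ≤ |y - β * t| := by
      by_contra! h
      exact hyu (hball (by rwa [Metric.mem_ball, Real.dist_eq]))
    rcases le_abs.1 hd with h | h
    · exact le_max_of_le_right (ha.antitoneOn (Set.mem_Ici.2 (by linarith))
        (Set.mem_Ici.2 (by linarith)) (by linarith))
    · exact le_max_of_le_left (hm.monotoneOn ⟨hy.le, by linarith⟩
        ⟨by linarith, by linarith⟩ (by linarith))

/-! ### Change of variables in the De Finetti measure -/

lemma one_sub_tanh_sq (y : ℝ) : 1 - Real.tanh y ^ 2 = (Real.cosh y ^ 2)⁻¹ := by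
  have := (Real.cosh_pos y).ne'
  rw [Real.tanh_eq_sinh_div_cosh]
  field_simp
  exact Real.cosh_sq_sub_sinh_sq y

/-- The exponent `n / 2 + 1` produces `cosh y ^ (n + 2)`: `n` factors enter the weight, and the
remaining two cancel the derivative of `tanh`. -/
lemma deFinettiWeight_tanh (n : ℕ) (β y : ℝ) :
    deFinettiWeight n β ((1 + Real.tanh y) / 2) = hsWeight β y ^ n * Real.cosh y ^ 2 := by
  have hc := Real.cosh_pos y
  have e : 2 * ((1 + Real.tanh y) / 2) - 1 = Real.tanh y := by ring
  rw [deFinettiWeight, e, Real.artanh_tanh, one_sub_tanh_sq, Real.log_inv, Real.log_pow, hsWeight,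
    mul_pow, ← Real.exp_nat_mul, mul_assoc, ← pow_add, ← Real.exp_log (pow_pos hc (n + 2)),
    Real.log_pow, ← Real.exp_add]
  congr 1
  push_cast
  ring

lemma measurable_deFinettiWeight (n : ℕ) (β : ℝ) : Measurable (deFinettiWeight n β) := by
  unfold deFinettiWeight Real.artanh
  fun_prop

lemma image_half_one_add_tanh :
    (fun y => (1 + Real.tanh y) / 2) '' Set.univ = Set.Ioo (0 : ℝ) 1 := by
  ext p
  constructor
  · rintro ⟨y, -, rfl⟩
    have := Real.tanh_bijOn.mapsTo (Set.mem_univ y)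
    exact ⟨by linarith [this.1], by linarith [this.2]⟩
  · intro hp
    refine ⟨Real.artanh (2 * p - 1), trivial, ?_⟩
    simp only
    rw [Real.tanh_artanh ⟨by linarith [hp.1], by linarith [hp.2]⟩]
    ring

section
variable {E : Type*} [NormedAddCommGroup E] [NormedSpace ℝ E]

lemma setIntegral_deFinettiWeight_smul (n : ℕ) (β : ℝ) (F : ℝ → E) :
    ∫ p in Set.Icc (0 : ℝ) 1, deFinettiWeight n β p • F p =
      (1 / 2 : ℝ) • ∫ y, hsWeight β y ^ n • F ((1 + Real.tanh y) / 2) := by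
  rw [integral_Icc_eq_integral_Ioo, ← image_half_one_add_tanh,
    integral_image_eq_integral_abs_deriv_smul MeasurableSet.univ
      (f' := fun y => 1 / Real.cosh y ^ 2 / 2)
      (fun y _ => (((hasDerivAt_tanh y).const_add 1).div_const 2).hasDerivWithinAt), ← integral_smul,
    Measure.restrict_univ]
  · refine integral_congr_ae (ae_of_all _ fun y => ?_)
    have hc := Real.cosh_pos y
    simp only [deFinettiWeight_tanh, smul_smul]
    congr 1
    rw [abs_of_pos (by positivity)]
    field_simp
  · intro x _ y _ h
    exact Real.tanh_injective (by simpa using h)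

lemma integral_deFinettiWeight (n : ℕ) (β : ℝ) :
    ∫ p in Set.Icc (0 : ℝ) 1, deFinettiWeight n β p = 1 / 2 * ∫ y, hsWeight β y ^ n := by
  simpa using setIntegral_deFinettiWeight_smul n β (fun _ => (1 : ℝ))

lemma integral_deFinettiMeasure (n : ℕ) (β : ℝ) (F : ℝ → E) :
    ∫ p, F p ∂deFinettiMeasure n β =
      (∫ y, hsWeight β y ^ n)⁻¹ • ∫ y, hsWeight β y ^ n • F ((1 + Real.tanh y) / 2) := by
  have hm := measurable_deFinettiWeight n β
  have hpos : ∀ p, 0 ≤ deFinettiWeight n β p := fun p => (Real.exp_pos _).le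
  rw [deFinettiMeasure, integral_withDensity_eq_integral_toReal_smul (by fun_prop) (by simp)]
  set I := ∫ q in Set.Icc (0 : ℝ) 1, deFinettiWeight n β q with hI
  have hI0 : 0 ≤ I := integral_nonneg hpos
  simp_rw [ENNReal.toReal_ofReal (div_nonneg (hpos _) hI0),
    fun p => div_eq_inv_mul (deFinettiWeight n β p) I, ← smul_smul]
  rw [integral_smul, setIntegral_deFinettiWeight_smul, hI, integral_deFinettiWeight, smul_smul]
  congr 1
  rw [mul_inv, mul_right_comm]
  norm_num

lemma ae_mem_Icc_deFinettiMeasure (n : ℕ) (β : ℝ) :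
    ∀ᵐ p ∂deFinettiMeasure n β, p ∈ Set.Icc (0 : ℝ) 1 :=
  (withDensity_absolutelyContinuous _ _).ae_le (ae_restrict_mem measurableSet_Icc)

/-- Folding onto the half-line leaves a single maximiser, as Laplace's method requires; both signs
then survive symmetrically in the test function. -/
lemma integral_even_hsWeight_pow_smul {β : ℝ} (hβ : 0 < β) {n : ℕ} (hn : 0 < n) {f : ℝ → E}
    (hf : Continuous f) {C : ℝ} (hC : ∀ x, ‖f x‖ ≤ C) :
    ∫ y, hsWeight β y ^ n • f y = ∫ y in Set.Ioi 0, hsWeight β y ^ n • (f y + f (-y)) := by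
  have hi : ∀ g : ℝ → E, Continuous g → (∀ x, ‖g x‖ ≤ C) →
      Integrable (fun y => hsWeight β y ^ n • g y) := fun g hg hgC =>
    (integrable_hsWeight_pow hβ hn).smul_bdd C hg.aestronglyMeasurable (ae_of_all _ hgC)
  have h1 := hi f hf hC
  have h2 := hi (fun y => f (-y)) (by fun_prop) (fun x => hC _)
  rw [← intervalIntegral.integral_Iic_add_Ioi h1.integrableOn h1.integrableOn (b := 0), add_comm]
  simp_rw [smul_add]
  rw [integral_add h1.integrableOn h2.integrableOn]
  congr 1
  rw [← neg_zero, ← integral_comp_neg_Ioi, neg_zero]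
  simp [hsWeight_neg]

end

/-! ### Concentration of the De Finetti measures -/

/-- The De Finetti measures concentrate, with equal masses, at the two minimisers of the rate. -/
theorem tendsto_integral_deFinettiMeasure {β t : ℝ} (hβ : 0 < β) (ht_pos : 0 < t)
    (ht : t = Real.tanh (β * t)) {f : ℝ → ℂ} (hf : Continuous f) {C : ℝ} (hC : ∀ x, ‖f x‖ ≤ C) :
    Tendsto (fun n : ℕ => ∫ p, f (2 * p - 1) ∂deFinettiMeasure n β) atTop
      (𝓝 ((f t + f (-t)) / 2)) := by
  set w := hsWeight β
  have hw := continuous_hsWeight β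
  have hwpos := hsWeight_pos β
  have hb : 0 < β * t := by positivity
  -- One factor of the weight goes into the reference measure to make it finite. The `n`-th power
  -- against `μ` therefore corresponds to `n + 1` spins, hence the index shift below.
  set μ : Measure ℝ := volume.withDensity fun y => ENNReal.ofReal (w y) with hμdef
  have hwm : Measurable fun y => ENNReal.ofReal (w y) := by
    have := hw.measurable
    fun_prop
  have : IsFiniteMeasure μ := isFiniteMeasure_withDensity_ofReal (integrable_hsWeight hβ).2
  have hconv : ∀ {E : Type} [NormedAddCommGroup E] [NormedSpace ℝ E] (F : ℝ → E),
      ∫ y in Set.Ioi 0, F y ∂μ = ∫ y in Set.Ioi 0, w y • F y := by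
    intro E _ _ F
    rw [hμdef, setIntegral_withDensity_eq_setIntegral_toReal_smul hwm (by simp) _ measurableSet_Ioi]
    exact integral_congr_ae (ae_of_all _ fun y => by
      simp only [w, ENNReal.toReal_ofReal (hwpos y).le])
  have htanh : Continuous Real.tanh :=
    continuous_iff_continuousAt.2 fun y => (hasDerivAt_tanh y).continuousAt
  set g : ℝ → ℂ := fun y => (f (Real.tanh y) + f (-Real.tanh y)) / 2
  have hg : Continuous g := by fun_prop
  have key := tendsto_setIntegral_pow_smul_of_gap (μ := μ) (s := Set.Ioi 0) measurableSet_Ioi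
    (c := w) (g := g) (x₀ := β * t) ?_ hw hwpos (hsWeight_le hβ) ?_ ?_ hg.continuousAt
  · have hlim : g (β * t) = (f t + f (-t)) / 2 := by simp only [g, ← ht]
    rw [hlim] at key
    rw [← tendsto_add_atTop_iff_nat 1]
    refine key.congr fun n => ?_
    rw [integral_deFinettiMeasure, hconv, hconv]
    have e1 := integral_even_hsWeight_pow_smul hβ (Nat.succ_pos n) (f := fun y => f (Real.tanh y))
      (by fun_prop) (fun x => hC _)
    have e2 : ∫ y, w y ^ (n + 1) = 2 * ∫ y in Set.Ioi 0, w y ^ (n + 1) := by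
      have := integral_even_hsWeight_pow_smul hβ (Nat.succ_pos n) (f := fun _ => (1 : ℝ))
        (by fun_prop) (C := 1) (fun x => by simp)
      simp only [smul_eq_mul, mul_one, Nat.succ_eq_add_one, integral_mul_const] at this
      rw [this]
      ring
    have e3 : ∀ y, 2 * ((1 + Real.tanh y) / 2) - 1 = Real.tanh y := fun y => by ring
    simp only [Nat.succ_eq_add_one, Real.tanh_neg] at e1
    simp only [e3, smul_smul, smul_eq_mul, ← pow_succ']
    rw [e1, e2, mul_inv_rev, ← smul_smul, ← integral_smul (2⁻¹ : ℝ)]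
    congr 1
    refine integral_congr_ae (ae_of_all _ fun y => ?_)
    simp only [g, w, Complex.real_smul]
    push_cast
    ring
  · intro u hu hx
    rw [hμdef, withDensity_apply _ (hu.measurableSet.inter measurableSet_Ioi),
      setLIntegral_pos_iff hwm]
    have : Function.support (fun y => ENNReal.ofReal (w y)) = Set.univ :=
      Set.eq_univ_of_forall fun y => by simpa using hwpos y
    rw [this, Set.univ_inter]
    exact (hu.inter isOpen_Ioi).measure_pos _ ⟨_, hx, hb⟩
  · intro u hu hx
    obtain ⟨r, hr, h⟩ := hsWeight_gap hβ ht_pos ht hu hx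
    exact ⟨r, hr, fun y hy => h y hy⟩
  · refine Integrable.of_bound hg.aestronglyMeasurable C (ae_of_all _ fun y => ?_)
    simp only [g, norm_div, RCLike.norm_ofNat]
    have := norm_add_le (f (Real.tanh y)) (f (-Real.tanh y))
    linarith [hC (Real.tanh y), hC (-Real.tanh y)]

/-! ### Spins with a fixed parameter -/

/-- Checked on boxes, where independence of the coordinates factorises the integral of the product.
-/
lemma pi_withDensity {ι : Type*} [Fintype ι] {α : ι → Type*} [∀ i, MeasurableSpace (α i)]
    (μ : ∀ i, Measure (α i)) [∀ i, IsProbabilityMeasure (μ i)] {h : ∀ i, α i → ENNReal}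
    (hh : ∀ i, Measurable (h i)) [∀ i, SigmaFinite ((μ i).withDensity (h i))] :
    Measure.pi (fun i => (μ i).withDensity (h i)) =
      (Measure.pi μ).withDensity fun x => ∏ i, h i (x i) := by
  refine Measure.pi_eq fun s hs => ?_
  have hind : iIndepFun (fun i (x : ∀ i, α i) => (s i).indicator (h i) (x i)) (Measure.pi μ) :=
    iIndepFun_pi fun i => ((hh i).indicator (hs i)).aemeasurable
  have key := lintegral_prod_eq_prod_lintegral_of_indepFun Finset.univ _ hind
    (fun i => ((hh i).indicator (hs i)).comp (measurable_pi_apply i))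
  rw [withDensity_apply _ (MeasurableSet.univ_pi hs), ← lintegral_indicator (MeasurableSet.univ_pi hs)]
  calc _ = ∫⁻ x, ∏ i, (s i).indicator (h i) (x i) ∂Measure.pi μ := by
        refine lintegral_congr fun x => ?_
        by_cases hx : x ∈ Set.univ.pi s
        · rw [Set.indicator_of_mem hx]
          exact Finset.prod_congr rfl fun i _ => by
            rw [Set.indicator_of_mem (hx i (Set.mem_univ i))]
        · rw [Set.indicator_of_notMem hx]
          simp only [Set.mem_pi, Set.mem_univ, true_imp_iff, not_forall] at hx
          obtain ⟨i, hi⟩ := hx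
          exact (Finset.prod_eq_zero (Finset.mem_univ i) (Set.indicator_of_notMem hi _)).symm
    _ = _ := by
        rw [key]
        refine Finset.prod_congr rfl fun i _ => ?_
        rw [withDensity_apply _ (hs i), ← lintegral_indicator (hs i)]
        exact (measurePreserving_eval μ i).lintegral_comp ((hh i).indicator (hs i))

instance : IsProbabilityMeasure signLaw := ⟨by
  simp [signLaw, ENNReal.inv_two_add_inv_two]⟩

lemma ae_signLaw_iff {p : ℝ → Prop} : (∀ᵐ x ∂signLaw, p x) ↔ p 1 ∧ p (-1) := by
  rw [signLaw, ae_add_measure_iff, Measure.ae_ennreal_smul_measure_iff (by simp),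
    Measure.ae_ennreal_smul_measure_iff (by simp), ae_dirac_eq, ae_dirac_eq]
  rfl

lemma measurable_spin : Measurable fun q : ℝ × ℝ => spin q.1 q.2 := by
  unfold spin
  exact ((Measurable.ite (measurableSet_lt measurable_fst measurable_snd) measurable_const
    measurable_const).const_mul 2).sub_const 1

lemma measurable_spin_left (p : ℝ) : Measurable fun u => spin u p :=
  measurable_spin.comp (measurable_id.prodMk measurable_const)

lemma measurable_spins (n : ℕ) :
    Measurable fun q : ℝ × (Fin n → ℝ) => fun k => spin (q.2 k) q.1 :=
  measurable_pi_lambda _ fun k =>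
    measurable_spin.comp (f := fun q : ℝ × (Fin n → ℝ) => (q.2 k, q.1)) (by fun_prop)

/-- The density is `2p` at `1` and `2(1 - p)` at `-1`, against masses one half. -/
lemma map_spin_uniform {p : ℝ} (hp : p ∈ Set.Icc (0 : ℝ) 1) :
    (volume.restrict (Set.Icc (0 : ℝ) 1)).map (fun u => spin u p) =
      signLaw.withDensity fun x => ENNReal.ofReal (1 + (2 * p - 1) * x) := by
  ext s hs
  have hlow : (volume.restrict (Set.Icc (0 : ℝ) 1)) (Set.Iio p) = ENNReal.ofReal p := by
    rw [Measure.restrict_apply measurableSet_Iio]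
    have : Set.Iio p ∩ Set.Icc 0 1 = Set.Ico 0 p := by
      ext u; simp only [Set.mem_inter_iff, Set.mem_Iio, Set.mem_Icc, Set.mem_Ico]
      have := hp.2
      constructor
      · rintro ⟨h1, h2, h3⟩; exact ⟨h2, h1⟩
      · rintro ⟨h1, h2⟩; exact ⟨h2, h1, by linarith⟩
    rw [this, Real.volume_Ico, sub_zero]
  have hup : (volume.restrict (Set.Icc (0 : ℝ) 1)) (Set.Ici p) = ENNReal.ofReal (1 - p) := by
    rw [Measure.restrict_apply measurableSet_Ici]
    have : Set.Ici p ∩ Set.Icc 0 1 = Set.Icc p 1 := by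
      ext u; simp only [Set.mem_inter_iff, Set.mem_Ici, Set.mem_Icc]
      have := hp.1
      constructor
      · rintro ⟨h1, h2, h3⟩; exact ⟨h1, h3⟩
      · rintro ⟨h1, h2⟩; exact ⟨h1, by linarith, h2⟩
    rw [this, Real.volume_Icc]
  have hhalf : ∀ x : ℝ, (2⁻¹ : ENNReal) * ENNReal.ofReal (2 * x) = ENNReal.ofReal x := by
    intro x
    rw [ENNReal.ofReal_mul (by norm_num), ← mul_assoc, ENNReal.ofReal_ofNat,
      ENNReal.inv_mul_cancel (by simp) (by simp), one_mul]
  have hL : (volume.restrict (Set.Icc (0 : ℝ) 1)).map (fun u => spin u p) s =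
      s.indicator (fun _ => ENNReal.ofReal p) 1 + s.indicator (fun _ => ENNReal.ofReal (1 - p)) (-1) := by
    rw [Measure.map_apply (measurable_spin_left p) hs,
      ← measure_inter_add_sdiff _ measurableSet_Iio (t := Set.Iio p)]
    congr 1
    · by_cases h : (1 : ℝ) ∈ s
      · rw [Set.indicator_of_mem h, ← hlow]
        congr 1
        ext u
        simp only [Set.mem_inter_iff, Set.mem_preimage, Set.mem_Iio, and_iff_right_iff_imp]
        intro hu
        simpa [spin, hu, show (2 : ℝ) - 1 = 1 by norm_num] using h
      · rw [Set.indicator_of_notMem h]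
        rw [← measure_empty (μ := volume.restrict (Set.Icc (0 : ℝ) 1))]
        congr 1
        ext u
        simp only [Set.mem_inter_iff, Set.mem_preimage, Set.mem_Iio, Set.mem_empty_iff_false,
          iff_false, not_and]
        intro hs' hu
        simp [spin, hu, show (2 : ℝ) - 1 = 1 by norm_num] at hs'
        exact h hs'
    · by_cases h : (-1 : ℝ) ∈ s
      · rw [Set.indicator_of_mem h, ← hup]
        congr 1
        ext u
        simp only [Set.mem_sdiff, Set.mem_preimage, Set.mem_Iio, not_lt, Set.mem_Ici,
          and_iff_right_iff_imp]
        intro hu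
        simpa [spin, not_lt.2 hu] using h
      · rw [Set.indicator_of_notMem h]
        rw [← measure_empty (μ := volume.restrict (Set.Icc (0 : ℝ) 1))]
        congr 1
        ext u
        simp only [Set.mem_sdiff, Set.mem_preimage, Set.mem_Iio, Set.mem_empty_iff_false,
          iff_false, not_and, not_not]
        intro hs'
        by_contra hu
        simp [spin, hu] at hs'
        exact h hs'
  rw [hL, withDensity_apply _ hs, ← lintegral_indicator hs, signLaw, lintegral_add_measure,
    lintegral_smul_measure, lintegral_smul_measure, lintegral_dirac, lintegral_dirac]
  congr 1
  · by_cases h : (1 : ℝ) ∈ s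
    · simp only [Set.indicator_of_mem h, smul_eq_mul]
      rw [← hhalf]; congr 2; ring
    · simp [h]
  · by_cases h : (-1 : ℝ) ∈ s
    · simp only [Set.indicator_of_mem h, smul_eq_mul]
      rw [← hhalf]; congr 2; ring
    · simp [h]

lemma map_spins_uniform (n : ℕ) {p : ℝ} (hp : p ∈ Set.Icc (0 : ℝ) 1) :
    (Measure.pi fun _ : Fin n => volume.restrict (Set.Icc (0 : ℝ) 1)).map
        (fun u k => spin (u k) p) =
      (Measure.pi fun _ : Fin n => signLaw).withDensity
        fun x => ∏ k, ENNReal.ofReal (1 + (2 * p - 1) * x k) := by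
  have hf : SigmaFinite (signLaw.withDensity fun x => ENNReal.ofReal (1 + (2 * p - 1) * x)) := by
    rw [← map_spin_uniform hp]
    have := Measure.isFiniteMeasure_map (volume.restrict (Set.Icc (0 : ℝ) 1)) (fun u => spin u p)
    infer_instance
  have hf' : SigmaFinite ((volume.restrict (Set.Icc (0 : ℝ) 1)).map fun u => spin u p) := by
    rwa [map_spin_uniform hp]
  rw [Measure.pi_map_pi fun _ => (measurable_spin_left p).aemeasurable]
  simp_rw [map_spin_uniform hp]
  exact pi_withDensity _ fun _ => by fun_prop

/-! ### The mixture is the Curie-Weiss law -/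

/-- Hubbard-Stratonovich transform: mixing the product laws over the De Finetti measure produces
the Curie-Weiss weight. -/
lemma exists_integral_prod_deFinettiMeasure {β : ℝ} (hβ : 0 < β) {n : ℕ} (hn : 0 < n) :
    ∃ K : ℝ, ∀ x : Fin n → ℝ, (∀ k, x k = 1 ∨ x k = -1) →
      ∫ p, ∏ k, (1 + (2 * p - 1) * x k) ∂deFinettiMeasure n β =
        K * Real.exp (β / (2 * n) * (∑ k, x k) ^ 2) := by
  refine ⟨(∫ y, hsWeight β y ^ n)⁻¹ * ∫ y, Real.exp (-(n / (2 * β)) * y ^ 2), fun x hx => ?_⟩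
  have hn' : (n : ℝ) ≠ 0 := by positivity
  rw [integral_deFinettiMeasure, smul_eq_mul, mul_assoc]
  congr 1
  -- After completing the square, the spins enter the Gaussian factor only through its centre, which
  -- translation invariance removes. Its integral is thus part of the constant `K`.
  have hpt : ∀ y, hsWeight β y ^ n • ∏ k, (1 + (2 * ((1 + Real.tanh y) / 2) - 1) * x k) =
      Real.exp (-(n / (2 * β)) * (y - β * (∑ k, x k) / n) ^ 2) *
        Real.exp (β / (2 * n) * (∑ k, x k) ^ 2) := by
    intro y
    have hc := (Real.cosh_pos y).ne'
    have hk : ∀ k, Real.cosh y * (1 + (2 * ((1 + Real.tanh y) / 2) - 1) * x k) =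
        Real.exp (y * x k) := by
      intro k
      have : Real.cosh y * (1 + (2 * ((1 + Real.tanh y) / 2) - 1) * x k) =
          Real.cosh y + Real.sinh y * x k := by
        rw [Real.tanh_eq_sinh_div_cosh]; field_simp; ring
      rw [this]
      rcases hx k with h | h
      · rw [h, mul_one, mul_one, Real.cosh_add_sinh]
      · rw [h, mul_neg_one, mul_neg_one, ← sub_eq_add_neg, Real.cosh_sub_sinh]
    have hprod : Real.cosh y ^ n * ∏ k, (1 + (2 * ((1 + Real.tanh y) / 2) - 1) * x k) =
        Real.exp (y * ∑ k, x k) := by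
      have := Finset.prod_mul_distrib (s := Finset.univ) (f := fun _ : Fin n => Real.cosh y)
        (g := fun k => 1 + (2 * ((1 + Real.tanh y) / 2) - 1) * x k)
      simp only [Finset.prod_const, Finset.card_univ, Fintype.card_fin] at this
      rw [← this, Finset.mul_sum, Real.exp_sum]
      exact Finset.prod_congr rfl fun k _ => hk k
    rw [hsWeight, mul_pow, smul_eq_mul, mul_assoc, hprod, ← Real.exp_nat_mul, ← Real.exp_add,
      ← Real.exp_add]
    congr 1
    field_simp
    ring
  simp_rw [hpt]
  rw [integral_mul_const, integral_sub_right_eq_self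
    (fun y => Real.exp (-(n / (2 * β)) * y ^ 2)) (β * (∑ k, x k) / n)]

section
variable {Ω : Type*} [MeasurableSpace Ω] {P : Measure Ω} [IsProbabilityMeasure P] {n : ℕ} {β : ℝ}
  {U : Fin n → Ω → ℝ} {V : Ω → ℝ}

lemma hasLaw_prodMk (hU : ∀ k, HasLaw (U k) (volume.restrict (Set.Icc (0 : ℝ) 1)) P)
    (hU_indep : iIndepFun U P) (hV : HasLaw V (deFinettiMeasure n β) P)
    (hUV_indep : IndepFun V (fun ω k => U k ω) P) :
    HasLaw (fun ω => (V ω, fun k => U k ω)) ((deFinettiMeasure n β).prod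
      (Measure.pi fun _ : Fin n => volume.restrict (Set.Icc (0 : ℝ) 1))) P := by
  have h := iIndepFun.hasLaw_pi hU hU_indep
  exact (indepFun_iff_hasLaw_prodMk_prod hV h).1 hUV_indep

/-- The spins built from the De Finetti variable have the Curie-Weiss law. -/
theorem hasLaw_spins (hβ : 0 < β) (hn : 0 < n)
    (hU : ∀ k, HasLaw (U k) (volume.restrict (Set.Icc (0 : ℝ) 1)) P)
    (hU_indep : iIndepFun U P) (hV : HasLaw V (deFinettiMeasure n β) P)
    (hUV_indep : IndepFun V (fun ω k => U k ω) P) :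
    HasLaw (fun ω k => spin (U k ω) (V ω)) (curieWeissLaw n β) P := by
  have hlaw := hasLaw_prodMk hU hU_indep hV hUV_indep
  have hm := measurable_spins n
  have haem : AEMeasurable (fun ω k => spin (U k ω) (V ω)) P := hm.comp_aemeasurable hlaw.aemeasurable
  refine ⟨haem, ?_⟩
  have : IsProbabilityMeasure (deFinettiMeasure n β) := hV.isProbabilityMeasure_iff.1 inferInstance
  set ν := deFinettiMeasure n β
  set Q := Measure.pi fun _ : Fin n => signLaw
  obtain ⟨K, hK⟩ := exists_integral_prod_deFinettiMeasure hβ hn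
  set e : (Fin n → ℝ) → ℝ := fun x => Real.exp (β / (2 * n) * (∑ k, x k) ^ 2) with he
  have hem : Measurable e := by fun_prop
  have hmix : P.map (fun ω k => spin (U k ω) (V ω)) =
      Q.withDensity fun x => ∫⁻ p, ∏ k, ENNReal.ofReal (1 + (2 * p - 1) * x k) ∂ν := by
    ext S hS
    have h1 : P.map (fun ω k => spin (U k ω) (V ω)) =
        (P.map (fun ω => (V ω, fun k => U k ω))).map
          (fun q : ℝ × (Fin n → ℝ) => fun k => spin (q.2 k) q.1) :=
      (AEMeasurable.map_map_of_aemeasurable hm.aemeasurable hlaw.aemeasurable).symm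
    rw [h1, hlaw.map_eq, Measure.map_apply hm hS, Measure.prod_apply (hm hS),
      withDensity_apply _ hS, lintegral_lintegral_swap (by fun_prop)]
    refine lintegral_congr_ae ?_
    filter_upwards [ae_mem_Icc_deFinettiMeasure n β] with p hp
    rw [← withDensity_apply _ hS, ← map_spins_uniform n hp, Measure.map_apply _ hS]
    · rfl
    · exact measurable_pi_lambda _ fun k => (measurable_spin_left p).comp (measurable_pi_apply k)
  have hQ : ∀ᵐ x ∂Q, ∀ k, x k = 1 ∨ x k = -1 := by
    refine ae_all_iff.2 fun k => ?_
    exact (measurePreserving_eval (fun _ : Fin n => signLaw) k).quasiMeasurePreserving.ae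
      (ae_signLaw_iff (p := fun x => x = 1 ∨ x = -1) |>.2 (by simp))
  have hD : (fun x => ∫⁻ p, ∏ k, ENNReal.ofReal (1 + (2 * p - 1) * x k) ∂ν) =ᵐ[Q]
      fun x => ENNReal.ofReal (K * e x) := by
    filter_upwards [hQ] with x hx
    have hnn : ∀ᵐ p ∂ν, ∀ k, 0 ≤ 1 + (2 * p - 1) * x k := by
      filter_upwards [ae_mem_Icc_deFinettiMeasure n β] with p hp k
      rcases hx k with h | h <;> rw [h] <;> linarith [hp.1, hp.2]
    rw [← hK x hx, ofReal_integral_eq_lintegral_ofReal]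
    · refine lintegral_congr_ae ?_
      filter_upwards [hnn] with p hp
      exact (ENNReal.ofReal_prod_of_nonneg fun k _ => hp k).symm
    · refine Integrable.of_bound (by fun_prop) (2 ^ n) ?_
      filter_upwards [hnn, ae_mem_Icc_deFinettiMeasure n β] with p hp hpI
      rw [Real.norm_of_nonneg (Finset.prod_nonneg fun k _ => hp k)]
      calc _ ≤ ∏ _k : Fin n, (2 : ℝ) := Finset.prod_le_prod (fun k _ => hp k) fun k _ => by
            rcases hx k with h | h <;> rw [h] <;> linarith [hpI.1, hpI.2]
        _ = 2 ^ n := by simp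
    · filter_upwards [hnn] with p hp using Finset.prod_nonneg fun k _ => hp k
  have hmap : P.map (fun ω k => spin (U k ω) (V ω)) =
      Q.withDensity fun x => ENNReal.ofReal (K * e x) := by
    rw [hmix, withDensity_congr_ae hD]
  -- The law has total mass one, which forces `K` to be the inverse partition function; its explicit
  -- value is never needed.
  have hmass : ∫⁻ x, ENNReal.ofReal (K * e x) ∂Q = 1 := by
    have := Measure.isProbabilityMeasure_map haem
    rw [hmap] at this
    rw [← setLIntegral_univ, ← withDensity_apply _ MeasurableSet.univ]
    exact this.measure_univ
  have hepos : ∀ x, 0 < e x := fun x => Real.exp_pos _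
  have hKpos : 0 < K := by
    by_contra! h
    simp [ENNReal.ofReal_of_nonpos (mul_nonpos_of_nonpos_of_nonneg h (hepos _).le)] at hmass
  have hint : Integrable (fun x => K * e x) Q :=
    ⟨by fun_prop, (hasFiniteIntegral_iff_ofReal
      (ae_of_all _ fun x => (mul_pos hKpos (hepos x)).le)).2 (by simp [hmass])⟩
  rw [← ofReal_integral_eq_lintegral_ofReal hint
    (ae_of_all _ fun x => (mul_pos hKpos (hepos x)).le), ENNReal.ofReal_eq_one,
    integral_const_mul] at hmass
  rw [hmap, curieWeissLaw, Measure.tilted]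
  congr 1
  funext x
  rw [eq_inv_of_mul_eq_one_left hmass, div_eq_inv_mul]

end

/-! ### Uniform Gaussian approximation of characteristic functions -/

lemma integral_signLaw {E : Type*} [NormedAddCommGroup E] [NormedSpace ℝ E] [CompleteSpace E]
    (f : ℝ → E) : ∫ x, f x ∂signLaw = (1 / 2 : ℝ) • (f 1 + f (-1)) := by
  have hi : ∀ a : ℝ, Integrable f ((2⁻¹ : ENNReal) • Measure.dirac a) := fun a =>
    (integrable_dirac (by simp)).smul_measure (by simp)
  rw [signLaw, integral_add_measure (hi 1) (hi (-1)), integral_smul_measure, integral_smul_measure,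
    integral_dirac, integral_dirac, smul_add]
  simp

lemma norm_pow_sub_pow_le {z w : ℂ} (hz : ‖z‖ ≤ 1) (hw : ‖w‖ ≤ 1) (n : ℕ) :
    ‖z ^ n - w ^ n‖ ≤ n * ‖z - w‖ := by
  induction n with
  | zero => simp
  | succ n ih =>
    have e : z ^ (n + 1) - w ^ (n + 1) = z ^ n * (z - w) + (z ^ n - w ^ n) * w := by ring
    rw [e]
    refine (norm_add_le _ _).trans ?_
    rw [norm_mul, norm_mul, norm_pow]
    have h1 : ‖z‖ ^ n * ‖z - w‖ ≤ 1 * ‖z - w‖ := by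
      gcongr; exact pow_le_one₀ (norm_nonneg _) hz
    have h2 : ‖z ^ n - w ^ n‖ * ‖w‖ ≤ n * ‖z - w‖ * 1 := by gcongr
    push_cast
    linarith

/-- The characteristic function of a centred spin with mean `2 * p - 1`. -/
def siteCharFun (r p : ℝ) : ℂ :=
  p * Complex.exp (Complex.I * (2 * r * (1 - p) : ℝ)) +
    (1 - p : ℝ) * Complex.exp (Complex.I * (-(2 * r * p) : ℝ))

lemma continuous_siteCharFun (r : ℝ) : Continuous (siteCharFun r) := by
  unfold siteCharFun; fun_prop

lemma norm_siteCharFun_le_one (r : ℝ) {p : ℝ} (hp : p ∈ Set.Icc (0 : ℝ) 1) :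
    ‖siteCharFun r p‖ ≤ 1 := by
  refine (norm_add_le _ _).trans ?_
  rw [norm_mul, norm_mul, Complex.norm_exp_I_mul_ofReal, Complex.norm_exp_I_mul_ofReal,
    Complex.norm_real, Complex.norm_real, Real.norm_of_nonneg hp.1,
    Real.norm_of_nonneg (sub_nonneg.2 hp.2)]
  linarith

lemma integral_exp_spin (r : ℝ) {p : ℝ} (hp : p ∈ Set.Icc (0 : ℝ) 1) :
    ∫ u in Set.Icc (0 : ℝ) 1, Complex.exp (Complex.I * (r * (spin u p - (2 * p - 1)) : ℝ)) =
      siteCharFun r p := by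
  have h := integral_map (μ := volume.restrict (Set.Icc (0 : ℝ) 1))
    (measurable_spin_left p).aemeasurable
    (f := fun x : ℝ => Complex.exp (Complex.I * (r * (x - (2 * p - 1)) : ℝ)))
    (by fun_prop)
  rw [← h, map_spin_uniform hp,
    integral_withDensity_eq_integral_toReal_smul (by fun_prop) (by simp), integral_signLaw,
    ENNReal.toReal_ofReal (by linarith [hp.1]), ENNReal.toReal_ofReal (by linarith [hp.2]),
    siteCharFun]
  simp only [Complex.real_smul]
  rw [show r * (1 - (2 * p - 1)) = 2 * r * (1 - p) by ring,
    show r * (-1 - (2 * p - 1)) = -(2 * r * p) by ring]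
  push_cast
  ring

lemma norm_exp_I_mul_sub_taylor_le {x : ℝ} (hx : |x| ≤ 1) :
    ‖Complex.exp (Complex.I * x) - (1 + Complex.I * x - (x : ℂ) ^ 2 / 2)‖ ≤ 2 / 9 * |x| ^ 3 := by
  have hn : ‖Complex.I * (x : ℂ)‖ = |x| := by simp
  have h := Complex.exp_bound (x := Complex.I * x) (by rw [hn]; exact hx) (n := 3) (by norm_num)
  rw [hn] at h
  have e : ∑ m ∈ Finset.range 3, (Complex.I * (x : ℂ)) ^ m / (m.factorial : ℂ) =
      1 + Complex.I * x - (x : ℂ) ^ 2 / 2 := by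
    simp [Finset.sum_range_succ, mul_pow]
    ring
  rw [e] at h
  refine h.trans_eq ?_
  norm_num [Nat.factorial]
  ring

lemma norm_siteCharFun_sub_exp_le {r p : ℝ} (hp : p ∈ Set.Icc (0 : ℝ) 1) (hr : |r| ≤ 1 / 2) :
    ‖siteCharFun r p - Real.exp (-(r ^ 2 * (1 - (2 * p - 1) ^ 2) / 2))‖ ≤ 2 * |r| ^ 3 := by
  obtain ⟨hp0, hp1⟩ := hp
  have hr0 := abs_nonneg r
  set x := 2 * r * (1 - p) with hx
  set y := -(2 * r * p) with hy
  set v := r ^ 2 * (1 - (2 * p - 1) ^ 2) / 2 with hv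
  have hxa : |x| ≤ 2 * |r| := by
    rw [hx, abs_mul, abs_mul, abs_two, abs_of_nonneg (sub_nonneg.2 hp1)]
    nlinarith
  have hya : |y| ≤ 2 * |r| := by
    rw [hy, abs_neg, abs_mul, abs_mul, abs_two, abs_of_nonneg hp0]
    nlinarith
  have hxc : |x| ^ 3 ≤ 8 * |r| ^ 3 := by
    calc |x| ^ 3 ≤ (2 * |r|) ^ 3 := by gcongr
      _ = _ := by ring
  have hyc : |y| ^ 3 ≤ 8 * |r| ^ 3 := by
    calc |y| ^ 3 ≤ (2 * |r|) ^ 3 := by gcongr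
      _ = _ := by ring
  have h1 := norm_exp_I_mul_sub_taylor_le (x := x) (by linarith)
  have h2 := norm_exp_I_mul_sub_taylor_le (x := y) (by linarith)
  have hv0 : 0 ≤ v := by
    have : 0 ≤ 1 - (2 * p - 1) ^ 2 := by nlinarith
    positivity
  have hvr : v ≤ |r| ^ 2 / 2 := by
    rw [hv, sq_abs]
    nlinarith [sq_nonneg (2 * p - 1), sq_nonneg r, mul_nonneg (sq_nonneg r) (sq_nonneg (2 * p - 1))]
  have h3 := Real.abs_exp_sub_one_sub_id_le (x := -v) (by rw [abs_neg, abs_of_nonneg hv0]; nlinarith)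
  -- From `v² ≤ |r|⁴ / 4` and `|r| ≤ 1/2`. Together with the Taylor errors, `2/9 * 8 = 16/9`, the
  -- total stays below `2`.
  have hv2 : (-v) ^ 2 ≤ |r| ^ 3 / 8 := by
    have : v ^ 2 ≤ (|r| ^ 2 / 2) ^ 2 := by gcongr
    nlinarith [pow_nonneg hr0 3]
  -- The mean `p * x + (1 - p) * y` vanishes and half the second moment is `v`, so both expansions
  -- start with `1 - v` and only remainders are left.
  have e : siteCharFun r p - Real.exp (-v) =
      p * (Complex.exp (Complex.I * x) - (1 + Complex.I * x - (x : ℂ) ^ 2 / 2)) +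
      (1 - p : ℝ) * (Complex.exp (Complex.I * y) - (1 + Complex.I * y - (y : ℂ) ^ 2 / 2)) -
      ((Real.exp (-v) - 1 - (-v) : ℝ) : ℂ) := by
    rw [siteCharFun, ← hx, ← hy]
    push_cast [hx, hy, hv]
    ring
  rw [e]
  refine (norm_sub_le _ _).trans ((add_le_add_left (norm_add_le _ _) _).trans ?_)
  rw [norm_mul, norm_mul, Complex.norm_real, Complex.norm_real, Complex.norm_real,
    Real.norm_of_nonneg hp0, Real.norm_of_nonneg (sub_nonneg.2 hp1), Real.norm_eq_abs]
  have h1' := mul_le_mul_of_nonneg_left (h1.trans (mul_le_mul_of_nonneg_left hxc (by norm_num))) hp0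
  have h2' := mul_le_mul_of_nonneg_left (h2.trans (mul_le_mul_of_nonneg_left hyc (by norm_num)))
    (sub_nonneg.2 hp1)
  nlinarith [pow_nonneg hr0 3]

lemma abs_exp_neg_sub_exp_neg_le {x y : ℝ} (hx : 0 ≤ x) (hy : 0 ≤ y) :
    |Real.exp (-x) - Real.exp (-y)| ≤ |x - y| := by
  wlog h : x ≤ y generalizing x y
  · rw [abs_sub_comm, abs_sub_comm x]
    exact this hy hx (le_of_not_ge h)
  have h1 : Real.exp (-y) ≤ Real.exp (-x) := by gcongr
  rw [abs_of_nonneg (sub_nonneg.2 h1), abs_sub_comm, abs_of_nonneg (sub_nonneg.2 h)]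
  have h2 : Real.exp (-y) = Real.exp (-x) * Real.exp (-(y - x)) := by
    rw [← Real.exp_add]; congr 1; ring
  have h3 := Real.add_one_le_exp (-(y - x))
  have h4 : Real.exp (-x) ≤ 1 := Real.exp_le_one_iff.2 (by linarith)
  have h5 := Real.exp_pos (-x)
  rw [h2]
  nlinarith

/-- A local limit estimate for centred spins that is uniform in the mean. -/
lemma norm_siteCharFun_pow_sub_exp_le {r p v : ℝ} (hp : p ∈ Set.Icc (0 : ℝ) 1) (hr : |r| ≤ 1 / 2)
    (hv : 0 ≤ v) (n : ℕ) :
    ‖siteCharFun r p ^ n - Real.exp (-(v * (1 - (2 * p - 1) ^ 2) / 2))‖ ≤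
      2 * (n * |r| ^ 3) + |n * r ^ 2 - v| := by
  have hq : 0 ≤ 1 - (2 * p - 1) ^ 2 := by nlinarith [hp.1, hp.2]
  have hq1 : 1 - (2 * p - 1) ^ 2 ≤ 1 := by nlinarith [sq_nonneg (2 * p - 1)]
  set q := 1 - (2 * p - 1) ^ 2
  have h1 := norm_siteCharFun_sub_exp_le hp hr
  have h2 := norm_pow_sub_pow_le (norm_siteCharFun_le_one r hp)
    (w := (Real.exp (-(r ^ 2 * q / 2)) : ℝ)) (by
      rw [Complex.norm_real, Real.norm_of_nonneg (Real.exp_pos _).le]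
      exact Real.exp_le_one_iff.2 (neg_nonpos.2 (by positivity))) n
  rw [← Complex.ofReal_pow, ← Real.exp_nat_mul] at h2
  have h3 := abs_exp_neg_sub_exp_neg_le (x := n * (r ^ 2 * q / 2)) (y := v * q / 2)
    (by positivity) (by positivity)
  have h4 : |n * (r ^ 2 * q / 2) - v * q / 2| ≤ |n * r ^ 2 - v| := by
    rw [show n * (r ^ 2 * q / 2) - v * q / 2 = (n * r ^ 2 - v) * (q / 2) by ring, abs_mul,
      abs_of_nonneg (show 0 ≤ q / 2 by positivity)]
    nlinarith [abs_nonneg (n * r ^ 2 - v)]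
  rw [mul_neg] at h2
  have h5 := norm_sub_le_norm_sub_add_norm_sub (siteCharFun r p ^ n)
    (Real.exp (-(n * (r ^ 2 * q / 2))) : ℂ) (Real.exp (-(v * q / 2)) : ℂ)
  rw [← Complex.ofReal_sub _ (Real.exp (-(v * q / 2))), Complex.norm_real, Real.norm_eq_abs] at h5
  have h6 : (n : ℝ) * ‖siteCharFun r p - (Real.exp (-(r ^ 2 * q / 2)) : ℝ)‖ ≤ n * (2 * |r| ^ 3) := by
    gcongr
  linarith

lemma isProbabilityMeasure_deFinettiMeasure {β : ℝ} (hβ : 0 < β) {n : ℕ} (hn : 0 < n) :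
    IsProbabilityMeasure (deFinettiMeasure n β) := by
  have h := integral_deFinettiMeasure n β (fun _ => (1 : ℝ))
  simp only [smul_eq_mul, mul_one, integral_const,
    inv_mul_cancel₀ (integral_hsWeight_pow_pos hβ hn).ne'] at h
  exact ⟨(ENNReal.toReal_eq_one_iff _).1 h⟩

section
variable {Ω : Type*} [MeasurableSpace Ω] {P : Measure Ω} [IsProbabilityMeasure P] {n : ℕ} {β : ℝ}
  {U : Fin n → Ω → ℝ} {V : Ω → ℝ}

/-- Conditioning on the parameter by Fubini: for fixed `p` the spins are i.i.d. and the exponential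
factorises. -/
lemma integral_exp_magnetisation (hβ : 0 < β) (hn : 0 < n)
    (hU : ∀ k, HasLaw (U k) (volume.restrict (Set.Icc (0 : ℝ) 1)) P)
    (hU_indep : iIndepFun U P) (hV : HasLaw V (deFinettiMeasure n β) P)
    (hUV_indep : IndepFun V (fun ω k => U k ω) P) (r b : ℝ) :
    ∫ ω, Complex.exp (Complex.I * (r * (magnetisation (fun k => U k ω) (V ω) -
        n * (2 * V ω - 1)) + b * (2 * V ω - 1) : ℝ)) ∂P =
      ∫ p, Complex.exp (Complex.I * (b * (2 * p - 1) : ℝ)) * siteCharFun r p ^ n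
        ∂deFinettiMeasure n β := by
  have := isProbabilityMeasure_deFinettiMeasure hβ hn
  have hlaw := hasLaw_prodMk hU hU_indep hV hUV_indep
  set F : ℝ × (Fin n → ℝ) → ℂ := fun q => Complex.exp (Complex.I * (r * (magnetisation q.2 q.1 -
        n * (2 * q.1 - 1)) + b * (2 * q.1 - 1) : ℝ)) with hF
  have hmag : Measurable fun q : ℝ × (Fin n → ℝ) => magnetisation q.2 q.1 :=
    Finset.measurable_fun_sum _ fun k _ => (measurable_pi_apply k).comp (measurable_spins n)
  have hFm : Measurable F := by fun_prop
  have e1 : ∫ ω, F (V ω, fun k => U k ω) ∂P = _ := hlaw.integral_comp hFm.aestronglyMeasurable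
  have : IsProbabilityMeasure (volume.restrict (Set.Icc (0 : ℝ) 1)) := ⟨by simp⟩
  have hint : Integrable F ((deFinettiMeasure n β).prod
      (Measure.pi fun _ : Fin n => volume.restrict (Set.Icc (0 : ℝ) 1))) :=
    Integrable.of_bound hFm.aestronglyMeasurable 1
      (ae_of_all _ fun q => (Complex.norm_exp_I_mul_ofReal _).le)
  refine e1.trans ?_
  rw [integral_prod _ hint]
  refine integral_congr_ae ?_
  filter_upwards [ae_mem_Icc_deFinettiMeasure n β] with p hp
  have hfact : ∀ u : Fin n → ℝ, F (p, u) = Complex.exp (Complex.I * (b * (2 * p - 1) : ℝ)) *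
      ∏ k, Complex.exp (Complex.I * (r * (spin (u k) p - (2 * p - 1)) : ℝ)) := by
    intro u
    rw [← Complex.exp_sum, ← Complex.exp_add, ← Finset.mul_sum, ← mul_add, ← Complex.ofReal_sum,
      ← Complex.ofReal_add, ← Finset.mul_sum, Finset.sum_sub_distrib]
    simp only [hF, magnetisation, Finset.sum_const, Finset.card_univ, Fintype.card_fin,
      nsmul_eq_mul]
    rw [add_comm]
  simp_rw [hfact]
  rw [integral_const_mul, integral_fintype_prod_eq_pow
    (fun u : ℝ => Complex.exp (Complex.I * (r * (spin u p - (2 * p - 1)) : ℝ))),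
    integral_exp_spin r hp, Fintype.card_fin]

end

/-! ### Limit of the characteristic functions -/

/-- The limit of the joint characteristic functions. -/
def limitCharFun (v b t : ℝ) : ℂ :=
  Real.exp (-(v * (1 - t ^ 2) / 2)) *
    ((Complex.exp (Complex.I * (b * t : ℝ)) + Complex.exp (Complex.I * (-(b * t) : ℝ))) / 2)

theorem tendsto_integral_siteCharFun {β t : ℝ} (hβ : 0 < β) (ht_pos : 0 < t)
    (ht : t = Real.tanh (β * t)) {r : ℕ → ℝ} {v : ℝ} (hv : 0 ≤ v) (b : ℝ)
    (hr : Tendsto r atTop (𝓝 0)) (hr3 : Tendsto (fun n => n * |r n| ^ 3) atTop (𝓝 0))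
    (hr2 : Tendsto (fun n => n * r n ^ 2) atTop (𝓝 v)) :
    Tendsto (fun n : ℕ => ∫ p, Complex.exp (Complex.I * (b * (2 * p - 1) : ℝ)) *
      siteCharFun (r n) p ^ n ∂deFinettiMeasure n β) atTop (𝓝 (limitCharFun v b t)) := by
  have ht1 : t < 1 := by
    rw [ht]; exact (Real.tanh_bijOn.mapsTo (Set.mem_univ (β * t))).2
  -- The absolute value keeps `f` bounded on the whole line and changes nothing on `[-1, 1]`, where
  -- `2p - 1` lives.
  set f : ℝ → ℂ := fun x => Complex.exp (Complex.I * (b * x : ℝ)) *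
    Real.exp (-(v * |1 - x ^ 2| / 2)) with hf
  have hfc : Continuous f := by fun_prop
  have hfb : ∀ x, ‖f x‖ ≤ 1 := fun x => by
    rw [hf, norm_mul, Complex.norm_exp_I_mul_ofReal, one_mul, Complex.norm_real,
      Real.norm_of_nonneg (Real.exp_pos _).le]
    exact Real.exp_le_one_iff.2 (neg_nonpos.2 (by positivity))
  have hlim := tendsto_integral_deFinettiMeasure hβ ht_pos ht hfc hfb
  have hval : (f t + f (-t)) / 2 = limitCharFun v b t := by
    simp only [hf, limitCharFun, neg_sq, mul_neg]
    rw [abs_of_nonneg (by nlinarith)]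
    ring
  rw [hval] at hlim
  have herr : Tendsto (fun n : ℕ => 2 * (n * |r n| ^ 3) + |n * r n ^ 2 - v|) atTop (𝓝 0) := by
    have h2 : Tendsto (fun n : ℕ => |n * r n ^ 2 - v|) atTop (𝓝 0) := by
      simpa using (hr2.sub_const v).abs
    simpa using (hr3.const_mul 2).add h2
  refine (tendsto_iff_of_dist (squeeze_zero' (Eventually.of_forall fun _ => dist_nonneg) ?_ herr)).2
    hlim
  have hsmall : ∀ᶠ n in atTop, |r n| ≤ 1 / 2 := by
    have := hr.abs
    rw [abs_zero] at this
    exact this.eventually_le_const (by norm_num)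
  filter_upwards [hsmall, eventually_gt_atTop 0] with n hrn hn
  have := isProbabilityMeasure_deFinettiMeasure hβ hn
  have hmem := ae_mem_Icc_deFinettiMeasure n β
  have hsc := continuous_siteCharFun (r n)
  rw [dist_eq_norm, ← integral_sub]
  · refine (norm_integral_le_of_norm_le_const (C := 2 * (n * |r n| ^ 3) + |n * r n ^ 2 - v|)
      ?_).trans_eq (by simp)
    filter_upwards [hmem] with p hp
    have hq : 0 ≤ 1 - (2 * p - 1) ^ 2 := by nlinarith [hp.1, hp.2]
    rw [hf]
    simp only
    rw [abs_of_nonneg hq, ← mul_sub, norm_mul, Complex.norm_exp_I_mul_ofReal, one_mul]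
    exact norm_siteCharFun_pow_sub_exp_le hp hrn hv n
  · refine Integrable.of_bound (by fun_prop) 1 ?_
    filter_upwards [hmem] with p hp
    rw [norm_mul, Complex.norm_exp_I_mul_ofReal, one_mul, norm_pow]
    exact pow_le_one₀ (norm_nonneg _) (norm_siteCharFun_le_one _ hp)
  · exact Integrable.of_bound (by fun_prop) 1 (ae_of_all _ fun p => hfb _)

/-! ### Lévy continuity in dimensions one and two -/

section
variable {Ω : ℕ → Type*} [∀ n, MeasurableSpace (Ω n)] {P : (n : ℕ) → Measure (Ω n)}
  [∀ n, IsProbabilityMeasure (P n)] {Ω' : Type*} [MeasurableSpace Ω'] {P' : Measure Ω'}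
  [IsProbabilityMeasure P']

lemma tendstoInDistribution_of_tendsto_integral_exp {X : (n : ℕ) → Ω n → ℝ} {X' : Ω' → ℝ}
    (hX : ∀ n, AEMeasurable (X n) (P n)) (hX' : AEMeasurable X' P')
    (h : ∀ a : ℝ, Tendsto (fun n => ∫ ω, Complex.exp (Complex.I * (a * X n ω : ℝ)) ∂P n) atTop
      (𝓝 (∫ ω, Complex.exp (Complex.I * (a * X' ω : ℝ)) ∂P'))) :
    TendstoInDistribution X atTop X' P P' where
  forall_aemeasurable := hX
  aemeasurable_limit := hX'
  tendsto := by
    refine ProbabilityMeasure.tendsto_of_tendsto_charFun fun a => ?_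
    simp only [ProbabilityMeasure.coe_mk, charFun_apply_real]
    convert h a using 2
    · rw [integral_map (hX _) (by fun_prop)]
      simp [mul_comm Complex.I]
    · rw [integral_map hX' (by fun_prop)]
      simp [mul_comm Complex.I]

lemma tendstoInDistribution_prodMk_of_tendsto_integral_exp {X Y : (n : ℕ) → Ω n → ℝ}
    {X' Y' : Ω' → ℝ} (hX : ∀ n, AEMeasurable (X n) (P n)) (hY : ∀ n, AEMeasurable (Y n) (P n))
    (hX' : AEMeasurable X' P') (hY' : AEMeasurable Y' P')
    (h : ∀ a b : ℝ,
      Tendsto (fun n => ∫ ω, Complex.exp (Complex.I * (a * X n ω + b * Y n ω : ℝ)) ∂P n) atTop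
        (𝓝 (∫ ω, Complex.exp (Complex.I * (a * X' ω + b * Y' ω : ℝ)) ∂P'))) :
    TendstoInDistribution (fun n ω => (X n ω, Y n ω)) atTop (fun ω => (X' ω, Y' ω)) P P' := by
  -- The pair is moved to the Euclidean plane, whose inner product defines the characteristic
  -- function, and brought back at the end by continuous mapping.
  have hm : ∀ n, AEMeasurable (fun ω => WithLp.toLp 2 (X n ω, Y n ω)) (P n) := fun n =>
    (WithLp.measurable_toLp 2 (ℝ × ℝ)).comp_aemeasurable ((hX n).prodMk (hY n))
  have hm' : AEMeasurable (fun ω => WithLp.toLp 2 (X' ω, Y' ω)) P' :=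
    (WithLp.measurable_toLp 2 (ℝ × ℝ)).comp_aemeasurable (hX'.prodMk hY')
  have key : TendstoInDistribution (fun n ω => WithLp.toLp 2 (X n ω, Y n ω)) atTop
      (fun ω => WithLp.toLp 2 (X' ω, Y' ω)) P P' :=
    { forall_aemeasurable := hm
      aemeasurable_limit := hm'
      tendsto := by
        refine ProbabilityMeasure.tendsto_of_tendsto_charFun fun a => ?_
        simp only [ProbabilityMeasure.coe_mk, charFun_apply]
        convert h a.fst a.snd using 2
        · rw [integral_map (hm _) (by fun_prop)]
          simp [WithLp.prod_inner_apply, mul_comm]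
        · rw [integral_map hm' (by fun_prop)]
          simp [WithLp.prod_inner_apply, mul_comm] }
  exact key.continuous_comp (WithLp.prod_continuous_ofLp 2 ℝ ℝ)

end

/-! ### Characteristic functions of the limit variables -/

section
variable {Ω' : Type*} [MeasurableSpace Ω'] {P' : Measure Ω'}

lemma integral_exp_sign {B : Ω' → ℝ} (hB : HasLaw B signLaw P') (a t : ℝ) :
    ∫ ω, Complex.exp (Complex.I * (a * (t * B ω) : ℝ)) ∂P' = limitCharFun 0 a t := by
  have h : ∫ ω, Complex.exp (Complex.I * (a * (t * B ω) : ℝ)) ∂P' = _ :=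
    hB.integral_comp (f := fun x : ℝ => Complex.exp (Complex.I * (a * (t * x) : ℝ))) (by fun_prop)
  rw [h, integral_signLaw, limitCharFun]
  simp
  ring

lemma integral_exp_gaussian {G : Ω' → ℝ} (hG : HasGaussianLaw G P') (h0 : ∫ ω, G ω ∂P' = 0)
    {v : ℝ} (hv : 0 ≤ v) (h2 : ∫ ω, G ω * G ω ∂P' = v) (a c : ℝ) :
    ∫ ω, Complex.exp (Complex.I * (a * G ω + c : ℝ)) ∂P' =
      Real.exp (-(a ^ 2 * v / 2)) * Complex.exp (Complex.I * (c : ℝ)) := by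
  have hvar : Var[G; P'] = v := by
    rw [variance_of_integral_eq_zero hG.aemeasurable h0, ← h2]
    simp [sq]
  have hlaw := hG.map_eq_gaussianReal
  rw [h0, hvar] at hlaw
  have hcf : charFun (P'.map G) a = Real.exp (-(a ^ 2 * v / 2)) := by
    rw [hlaw, charFun_gaussianReal]
    simp only [Complex.ofReal_zero, mul_zero, zero_mul, zero_sub, Complex.ofReal_exp]
    congr 1
    rw [Real.coe_toNNReal _ hv]
    push_cast
    ring
  rw [← hcf, charFun_apply_real, integral_map hG.aemeasurable (by fun_prop), ← integral_mul_const]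
  refine integral_congr_ae (ae_of_all _ fun ω => ?_)
  simp only [← Complex.exp_add]
  congr 1
  push_cast
  ring

/-- Conditionally on `B = ±1` only one Gaussian remains. The two variances agree, so the Gaussian
factor comes out of the average over `B`. -/
lemma integral_exp_limit [IsProbabilityMeasure P'] {Gp Gm B : Ω' → ℝ} (hG : HasGaussianLaw (fun ω => (Gp ω, Gm ω)) P')
    (hB : HasLaw B signLaw P') (hGB : IndepFun (fun ω => (Gp ω, Gm ω)) B P')
    (hp0 : ∫ ω, Gp ω ∂P' = 0) (hm0 : ∫ ω, Gm ω ∂P' = 0) {t : ℝ} (ht : 0 ≤ 1 - t ^ 2)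
    (hp2 : ∫ ω, Gp ω * Gp ω ∂P' = 1 - t ^ 2) (hm2 : ∫ ω, Gm ω * Gm ω ∂P' = 1 - t ^ 2) (a b : ℝ) :
    ∫ ω, Complex.exp (Complex.I *
        (a * ((1 + B ω) / 2 * Gp ω + (1 - B ω) / 2 * Gm ω) + b * (t * B ω) : ℝ)) ∂P' =
      limitCharFun (a ^ 2) b t := by
  have hGlaw : HasLaw (fun ω => (Gp ω, Gm ω)) (P'.map fun ω => (Gp ω, Gm ω)) P' :=
    ⟨hG.aemeasurable, rfl⟩
  have hprob := Measure.isProbabilityMeasure_map hG.aemeasurable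
  have hlaw := (indepFun_iff_hasLaw_prodMk_prod hGlaw hB).1 hGB
  set F : (ℝ × ℝ) × ℝ → ℂ := fun q => Complex.exp (Complex.I *
        (a * ((1 + q.2) / 2 * q.1.1 + (1 - q.2) / 2 * q.1.2) + b * (t * q.2) : ℝ)) with hF
  have hFc : Continuous F := by fun_prop
  have e1 : ∫ ω, F ((Gp ω, Gm ω), B ω) ∂P' = _ := 
    hlaw.integral_comp (f := F) hFc.aestronglyMeasurable
  have hint : Integrable F ((P'.map fun ω => (Gp ω, Gm ω)).prod signLaw) :=
    Integrable.of_bound (by fun_prop) 1 (ae_of_all _ fun q => (Complex.norm_exp_I_mul_ofReal _).le)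
  refine e1.trans ?_
  rw [integral_prod _ hint]
  simp_rw [integral_signLaw]
  rw [integral_smul, integral_map hG.aemeasurable (by fun_prop), integral_add]
  · have hp := integral_exp_gaussian hG.fst hp0 ht hp2 a (b * t)
    have hm := integral_exp_gaussian hG.snd hm0 ht hm2 a (-(b * t))
    have hp' : ∫ ω, F ((Gp ω, Gm ω), 1) ∂P' =
        ∫ ω, Complex.exp (Complex.I * (a * Gp ω + b * t : ℝ)) ∂P' := by
      refine integral_congr_ae (ae_of_all _ fun ω => ?_)
      simp [hF]
    have hm' : ∫ ω, F ((Gp ω, Gm ω), -1) ∂P' =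
        ∫ ω, Complex.exp (Complex.I * (a * Gm ω + -(b * t) : ℝ)) ∂P' := by
      refine integral_congr_ae (ae_of_all _ fun ω => ?_)
      simp only [hF]
      congr 3
      ring
    rw [hp', hm', hp, hm, limitCharFun, Complex.real_smul]
    push_cast
    ring
  all_goals
    have := hG.aemeasurable
    refine Integrable.of_bound ?_ 1 (ae_of_all _ fun q => (Complex.norm_exp_I_mul_ofReal _).le)
    exact (hFc.comp (by fun_prop : Continuous fun g : ℝ × ℝ => (g, _))).measurable.comp_aemeasurable
      this |>.aestronglyMeasurable

end

end CurieWeiss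

end

/-! ### The main theorem -/

theorem mainTheorem3
    (β : ℝ) (hβ : 1 < β)
    -- `t` is the positive solution of `t = tanh (β t)`
    (t : ℝ) (ht_pos : 0 < t) (ht : t = Real.tanh (β * t))
    -- for every `n`, i.i.d. uniform variables and an independent variable `V n` with the
    -- De Finetti law, on a probability space that may depend on `n`
    {Ω : ℕ → Type*} [∀ n, MeasurableSpace (Ω n)]
    (P : (n : ℕ) → Measure (Ω n)) [∀ n, IsProbabilityMeasure (P n)]
    (U : (n : ℕ) → Fin n → Ω n → ℝ) (V : (n : ℕ) → Ω n → ℝ)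
    (hU : ∀ n k, HasLaw (U n k) (volume.restrict (Set.Icc (0 : ℝ) 1)) (P n))
    (hU_indep : ∀ n, iIndepFun (U n) (P n))
    (hV_meas : ∀ n, AEMeasurable (V n) (P n))
    (hV : ∀ n, 0 < n → HasLaw (V n) (CurieWeiss.deFinettiMeasure n β) (P n))
    (hUV_indep : ∀ n, IndepFun (V n) (fun ω k => U n k ω) (P n))
    -- the probability space of the limit: a Brownian bridge `Z` and a symmetric sign `B`
    {Ω' : Type*} [MeasurableSpace Ω'] (P' : Measure Ω') [IsProbabilityMeasure P']
    (Z : ℝ → Ω' → ℝ) (hZ : CurieWeiss.IsBrownianBridge Z P')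
    (B : Ω' → ℝ) (hB : HasLaw B CurieWeiss.signLaw P')
    (M T : (n : ℕ) → Ω n → ℝ)
    (hM : ∀ n ω, M n ω = CurieWeiss.magnetisation (fun k => U n k ω) (V n ω))
    (hT : ∀ n ω, T n ω = 2 * V n ω - 1)
    (Gp Gm : Ω' → ℝ)
    (hGp : ∀ ω, Gp ω = 2 * Z ((1 + t) / 2) ω)
    (hGm : ∀ ω, Gm ω = 2 * Z ((1 - t) / 2) ω)
    (hGB_indep : IndepFun (fun ω => (Gp ω, Gm ω)) B P') :
    -- the spins have the Curie-Weiss law, so `M n` is the Curie-Weiss magnetisation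
    (∀ n, 0 < n → HasLaw (fun ω k => CurieWeiss.spin (U n k ω) (V n ω))
      (CurieWeiss.curieWeissLaw n β) (P n)) ∧
    -- law of large numbers
    TendstoInDistribution (fun (n : ℕ) ω => M n ω / n) atTop (fun ω => t * B ω) P P' ∧
    -- joint fluctuations
    TendstoInDistribution
      (fun (n : ℕ) ω => (√(n : ℝ) * (M n ω / n - T n ω), T n ω)) atTop
      (fun ω => ((1 + B ω) / 2 * Gp ω + (1 - B ω) / 2 * Gm ω, t * B ω)) P P' ∧
    -- the law of the Gaussian pair
    HasGaussianLaw (fun ω => (Gp ω, Gm ω)) P' ∧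
    ∫ ω, Gp ω ∂P' = 0 ∧ ∫ ω, Gm ω ∂P' = 0 ∧
    ∫ ω, Gp ω * Gm ω ∂P' = (1 - t) ^ 2 := by
  have hβ0 : 0 < β := by linarith
  have ht1 : t < 1 := by
    rw [ht]; exact (Real.tanh_bijOn.mapsTo (Set.mem_univ (β * t))).2
  have hpI : (1 + t) / 2 ∈ Set.Icc (0 : ℝ) 1 := ⟨by linarith, by linarith⟩
  have hmI : (1 - t) / 2 ∈ Set.Icc (0 : ℝ) 1 := ⟨by linarith, by linarith⟩
  have hgauss : HasGaussianLaw (fun ω => (Gp ω, Gm ω)) P' := by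
    have h := (hZ.isGaussianProcess.hasGaussianLaw_prodMk (s := ⟨_, hpI⟩) (t := ⟨_, hmI⟩)).fun_smul 2
    simpa only [hGp, hGm, Prod.smul_mk, smul_eq_mul] using h
  have hmul : ∀ p ∈ Set.Icc (0 : ℝ) 1, ∀ q ∈ Set.Icc (0 : ℝ) 1,
      ∫ ω, 2 * Z p ω * (2 * Z q ω) ∂P' = 4 * (min p q - p * q) := by
    intro p hp q hq
    rw [← hZ.covariance p hp q hq, ← integral_const_mul]
    exact integral_congr_ae (ae_of_all _ fun ω => by ring)
  have hp0 : ∫ ω, Gp ω ∂P' = 0 := by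
    simp_rw [hGp]; rw [integral_const_mul, hZ.centred _ hpI, mul_zero]
  have hm0 : ∫ ω, Gm ω ∂P' = 0 := by
    simp_rw [hGm]; rw [integral_const_mul, hZ.centred _ hmI, mul_zero]
  have hp2 : ∫ ω, Gp ω * Gp ω ∂P' = 1 - t ^ 2 := by
    simp_rw [hGp]; rw [hmul _ hpI _ hpI, min_self]; ring
  have hm2 : ∫ ω, Gm ω * Gm ω ∂P' = 1 - t ^ 2 := by
    simp_rw [hGm]; rw [hmul _ hmI _ hmI, min_self]; ring
  have hpm : ∫ ω, Gp ω * Gm ω ∂P' = (1 - t) ^ 2 := by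
    simp_rw [hGp, hGm]
    rw [hmul _ hpI _ hmI, min_eq_right (by linarith)]; ring
  have hGpm : AEMeasurable Gp P' := hgauss.fst.aemeasurable
  have hGmm : AEMeasurable Gm P' := hgauss.snd.aemeasurable
  have hBm : AEMeasurable B P' := hB.aemeasurable
  have hTm : ∀ n, AEMeasurable (T n) (P n) := fun n => by
    have := hV_meas n
    rw [show T n = fun ω => 2 * V n ω - 1 from funext (hT n)]
    fun_prop
  have hMm : ∀ n, AEMeasurable (M n) (P n) := fun n => by
    rw [show M n = fun ω => ∑ k, CurieWeiss.spin (U n k ω) (V n ω) from funext (hM n)]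
    exact Finset.aemeasurable_fun_sum _ fun k _ =>
      CurieWeiss.measurable_spin.comp_aemeasurable ((hU n k).aemeasurable.prodMk (hV_meas n))
  have hcf : ∀ n, 0 < n → ∀ r b : ℝ,
      ∫ ω, Complex.exp (Complex.I * (r * (M n ω - n * T n ω) + b * T n ω : ℝ)) ∂P n =
        ∫ p, Complex.exp (Complex.I * (b * (2 * p - 1) : ℝ)) * CurieWeiss.siteCharFun r p ^ n
          ∂CurieWeiss.deFinettiMeasure n β := fun n hn r b => by
    simp_rw [hM, hT]
    exact CurieWeiss.integral_exp_magnetisation hβ0 hn (hU n) (hU_indep n) (hV n hn)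
      (hUV_indep n) r b
  have hinv : Tendsto (fun n : ℕ => (√(n : ℝ))⁻¹) atTop (𝓝 0) :=
    tendsto_inv_atTop_zero.comp (Real.tendsto_sqrt_atTop.comp tendsto_natCast_atTop_atTop)
  refine ⟨fun n hn => CurieWeiss.hasLaw_spins hβ0 hn (hU n) (hU_indep n) (hV n hn) (hUV_indep n),
    ?_, ?_, hgauss, hp0, hm0, hpm⟩
  · refine CurieWeiss.tendstoInDistribution_of_tendsto_integral_exp
      (fun n => (hMm n).div_const _) (hBm.const_mul t) fun a => ?_
    rw [CurieWeiss.integral_exp_sign hB]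
    have hinvn : Tendsto (fun n : ℕ => (n : ℝ)⁻¹) atTop (𝓝 0) :=
      tendsto_inv_atTop_zero.comp tendsto_natCast_atTop_atTop
    -- Here `a * M / n = (a / n) * (M - n * T) + a * T`, so `r = a / n` and `b = a`; since `n * r² =
    -- a² / n`, the Gaussian part vanishes.
    have hlim := CurieWeiss.tendsto_integral_siteCharFun hβ0 ht_pos ht (r := fun n => a * (n : ℝ)⁻¹)
      (v := 0) le_rfl a (by simpa using hinvn.const_mul a) ?_ ?_
    · refine hlim.congr' ?_
      filter_upwards [eventually_gt_atTop 0] with n hn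
      rw [← hcf n hn]
      refine integral_congr_ae (ae_of_all _ fun ω => ?_)
      have : (n : ℝ) ≠ 0 := by positivity
      simp only
      congr 3
      field_simp
      ring
    · have h := (hinvn.pow 2).const_mul (|a| ^ 3)
      rw [zero_pow two_ne_zero, mul_zero] at h
      refine h.congr' ?_
      filter_upwards [eventually_gt_atTop 0] with n hn
      rw [abs_mul, abs_inv, Nat.abs_cast]
      field_simp
    · have h := hinvn.const_mul (a ^ 2)
      rw [mul_zero] at h
      refine h.congr' ?_
      filter_upwards [eventually_gt_atTop 0] with n hn
      field_simp
  · refine CurieWeiss.tendstoInDistribution_prodMk_of_tendsto_integral_exp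
      (fun n => (((hMm n).div_const _).sub (hTm n)).const_mul _) hTm (by fun_prop)
      (hBm.const_mul t) fun a b => ?_
    rw [CurieWeiss.integral_exp_limit hgauss hB hGB_indep hp0 hm0 (by nlinarith) hp2 hm2]
    -- Here `√n * (M / n - T) = (M - n * T) / √n`, so `r = a / √n` and `n * r² = a²` exactly for `n
    -- > 0`.
    have hlim := CurieWeiss.tendsto_integral_siteCharFun hβ0 ht_pos ht
      (r := fun n => a * (√(n : ℝ))⁻¹) (v := a ^ 2) (sq_nonneg a) b
      (by simpa using hinv.const_mul a) ?_ ?_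
    · refine hlim.congr' ?_
      filter_upwards [eventually_gt_atTop 0] with n hn
      rw [← hcf n hn]
      refine integral_congr_ae (ae_of_all _ fun ω => ?_)
      have h1 : √(n : ℝ) ≠ 0 := by positivity
      have h2 : √(n : ℝ) * √(n : ℝ) = n := Real.mul_self_sqrt (by positivity)
      have h3 : (n : ℝ) ≠ 0 := by positivity
      have h4 : (√(n : ℝ))⁻¹ = √(n : ℝ) / n := by
        rw [eq_div_iff h3, inv_mul_eq_iff_eq_mul₀ h1, h2]
      simp only
      congr 4
      rw [mul_assoc, h4]
      congr 1
      field_simp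
    · have h := hinv.const_mul (|a| ^ 3)
      rw [mul_zero] at h
      refine h.congr' ?_
      filter_upwards [eventually_gt_atTop 0] with n hn
      have h1 : √(n : ℝ) ≠ 0 := by positivity
      have h2 : √(n : ℝ) * √(n : ℝ) = n := Real.mul_self_sqrt (by positivity)
      rw [abs_mul, abs_inv, abs_of_nonneg (Real.sqrt_nonneg _)]
      nth_rewrite 2 [← h2]
      field_simp
    · refine tendsto_const_nhds.congr' ?_
      filter_upwards [eventually_gt_atTop 0] with n hn
      have h1 : √(n : ℝ) ≠ 0 := by positivity
      have h2 : √(n : ℝ) * √(n : ℝ) = n := Real.mul_self_sqrt (by positivity)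
      nth_rewrite 1 [← h2]
      field_simp
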